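/- Composition is written in diagrammatic order ($f\circ g$ means first $f$, then $g$). **Setting.** Let $\mathcal C$ be a category with a chosen final object $pt$ and a *universe*: a morphism $p:\widetilde U\to U$ together with a chosen pull-back square, with projections $p_{X,F}:(X;F)\to X$ and $Q(F):(X;F)\to\widetilde U$ (so $Q(F)\circ p=p_{X,F}\circ F$), for every $F:X\to U$. For $f:X'\to X$ let $Q(f,F):(X';f\circ F)\to(X;F)$ be the morphism with $Q(f,F)\circ p_{X,F}=p_{X',f\circ F}\circ f$ and $Q(f,F)\circ Q(F)=Q(f\circ F)$. Let $\mathcal C$ also carry a locally cartesian closed structure: chosen fiber products $(X,f)\times_Z(Y,g)$; chosen objects $\underline{Hom}_Z((X,f),(Y,g))$ over $Z$, functorial in $(Y,g)\in\mathcal C/Z$; and morphisms $ev:\underline{Hom}_Z((X,f),(Y,g))\times_Z(X,f)\to (Y,g)$ over $Z$, natural in $(Y,g)$, such that $u\mapsto (u\times Id_X)\circ ev$ is a bijection $Hom_Z((W,h),\underline{Hom}_Z((X,f),(Y,g)))\to Hom_Z((W,h)\times_Z(X,f),(Y,g))$ for all $h:W\to Z$. Put $I_p(V)=\underline{Hom}_U((\widetilde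 U,p),(U\times V,pr_1))$ with structure morphism $prI_p(V):I_p(V)\to U$, and $I_p(b)=\underline{Hom}_U((\widetilde U,p),Id_U\times b)$ for $b:V\to V'$. **The C-system $CC(\mathcal C,p)$.** Let $Ob_0$ be a one-point set with $int_0=pt$, let $Ob_{n+1}=\coprod_{A\in Ob_n}Hom(int(A),U)$ and $int(A,F)=(int(A);F)$. The objects of $CC(\mathcal C,p)$ are the pairs $\Gamma=(n,A)$ with $A\in Ob_n$ (and $int(\Gamma)=int(A)$, $l(\Gamma)=n$), and the morphisms $\Gamma\to\Gamma'$ are the morphisms $int(\Gamma)\to int(\Gamma')$. One has $ft(n+1,(A,F))=(n,A)$ with canonical projection $p_{int(A),F}$, and the canonical pull-back of $(n+1,(A,F))$ along $f:(m,B)\to(n,A)$ is $(m+1,(B,f\circ F))$, with $q(f,(n+1,(A,F)))=Q(f,F)$. **$(\Pi,\lambda)$-structures.** In a C-system let $Ob_n(\Gamma)$ be the set of objects $\Delta$ with $l(\Delta)\ge n+l(\Gamma)$ and $ft^n(\Delta)=\Gamma$; let $\widetilde{Ob}_n(\Gamma)$ be the set of sections $s:ft(\Delta)\to\Delta$ of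 canonical projections with $l(\Delta)>0$ and $\partial(s):=\Delta\in Ob_n(\Gamma)$; for $f:\Gamma'\to\Gamma$ let $f^*:Ob_n(\Gamma)\to Ob_n(\Gamma')$ and, for $n\ge 1$, $f^*:\widetilde{Ob}_n(\Gamma)\to\widetilde{Ob}_n(\Gamma')$ be given by iterated canonical pull-back. A $(\Pi,\lambda)$-structure is a pair of families of functions $\Pi_\Gamma:Ob_2(\Gamma)\to Ob_1(\Gamma)$, $\lambda_\Gamma:\widetilde{Ob}_2(\Gamma)\to\widetilde{Ob}_1(\Gamma)$ such that $\partial(\lambda_\Gamma(s))=\Pi_\Gamma(\partial(s))$, both families commute with all $f^*$, and for every $\Gamma$ the square of sets formed by $\lambda_\Gamma,\partial,\partial,\Pi_\Gamma$ is a pull-back square. **The bijections.** Let $D_p(X,V)=\coprod_{F:X\to U}Hom((X;F),V)$. For an object $\Gamma$ of $CC(\mathcal C,p)$ there are bijections $u_1:Ob_1(\Gamma)\to Hom(int(\Gamma),U)$, $(n+1,(A,F))\mapsto F$; $\widetilde u_1:\widetilde{Ob}_1(\Gamma)\to Hom(int(\Gamma),\widetilde U)$, $o\mapsto int(o)\circ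 Q(u_1(\partial(o)))$, where $int(o)$ is $o$ regarded as a morphism of $\mathcal C$; $u_2:Ob_2(\Gamma)\to D_p(int(\Gamma),U)$, $T\mapsto(u_{1,\Gamma}(ft(T)),u_{1,ft(T)}(T))$; $\widetilde u_2:\widetilde{Ob}_2(\Gamma)\to D_p(int(\Gamma),\widetilde U)$, $o\mapsto(u_{1,\Gamma}(ft(\partial(o))),\widetilde u_{1,ft(\partial(o))}(o))$. Moreover there is a bijection $\eta:D_p(X,V)\to Hom(X,I_p(V))$ whose inverse is $g\mapsto(g\circ prI_p(V),\,Q(g,prI_p(V))\circ st_p(V))$, where $st_p(V):(I_p(V);prI_p(V))\to V$ is the composite of the canonical isomorphism $(I_p(V);prI_p(V))\to (I_p(V),prI_p(V))\times_U(\widetilde U,p)$, the evaluation $ev$ to $U\times V$, and $pr_2$. **Statement.** Let $\widetilde P:I_p(\widetilde U)\to\widetilde U$ and $P:I_p(U)\to U$ be a $\Pi$-structure on $p$, i.e. let the square with sides $\widetilde P$, $I_p(p)$, $p$, $P$ commute ($\widetilde P\circ p=I_p(p)\circ P$) and be a pull-back square. Then the families $$\Pi_\Gamma(T)=u_1^{-1}\bigl(\eta(u_2(T))\circ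 P\bigr)\quad(T\in Ob_2(\Gamma)),\qquad \lambda_\Gamma(s)=\widetilde u_1^{-1}\bigl(\eta(\widetilde u_2(s))\circ\widetilde P\bigr)\quad(s\in\widetilde{Ob}_2(\Gamma))$$ form a $(\Pi,\lambda)$-structure on the C-system $CC(\mathcal C,p)$. -/

import Mathlib

open CategoryTheory CategoryTheory.Limits

-- Makes `X ⟶ Y` elaborate through the usual quiver instance of a category.
attribute [-instance] CategoryTheory.catToReflQuiver

universe u v

/-! ### C-systems -/

/-- A C-system (contextual category) with set of objects `Ob`: a length function `len`, a distinguished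
final object `pt`, the father map `ft`, the projections `p X : X ⟶ ft X`, and strictly functorial
canonical pull-backs `pb X _ f = f^*(X)` with the morphisms `q X _ f = q(f, X) : f^*(X) ⟶ X`,
defined for `X` of positive length and `f : Y ⟶ ft X`. -/
class CSystem (Ob : Type u) extends Category.{v} Ob where
  len : Ob → ℕ
  pt : Ob
  ft : Ob → Ob
  p : ∀ X : Ob, X ⟶ ft X
  pb : ∀ (X : Ob) (_ : 0 < len X) {Y : Ob} (_ : Y ⟶ ft X), Ob
  q : ∀ (X : Ob) (hX : 0 < len X) {Y : Ob} (f : Y ⟶ ft X), pb X hX f ⟶ X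
  len_eq_zero_iff : ∀ X : Ob, len X = 0 ↔ X = pt
  len_ft : ∀ X : Ob, 0 < len X → len (ft X) = len X - 1
  ft_pt : ft pt = pt
  isTerminal : Nonempty (IsTerminal pt)
  len_pb : ∀ (X : Ob) (hX : 0 < len X) {Y : Ob} (f : Y ⟶ ft X), 0 < len (pb X hX f)
  ft_pb : ∀ (X : Ob) (hX : 0 < len X) {Y : Ob} (f : Y ⟶ ft X), ft (pb X hX f) = Y
  isPullback : ∀ (X : Ob) (hX : 0 < len X) {Y : Ob} (f : Y ⟶ ft X),
    IsPullback (q X hX f) (p (pb X hX f) ≫ eqToHom (ft_pb X hX f)) (p X) f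
  pb_id : ∀ (X : Ob) (hX : 0 < len X), pb X hX (𝟙 (ft X)) = X
  q_id : ∀ (X : Ob) (hX : 0 < len X), q X hX (𝟙 (ft X)) = eqToHom (pb_id X hX)
  pb_comp : ∀ (X : Ob) (hX : 0 < len X) {Y Z : Ob} (f : Y ⟶ ft X) (g : Z ⟶ Y),
    pb X hX (g ≫ f) = pb (pb X hX f) (len_pb X hX f) (g ≫ eqToHom (ft_pb X hX f).symm)
  q_comp : ∀ (X : Ob) (hX : 0 < len X) {Y Z : Ob} (f : Y ⟶ ft X) (g : Z ⟶ Y),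
    q X hX (g ≫ f) = eqToHom (pb_comp X hX f g) ≫
      q (pb X hX f) (len_pb X hX f) (g ≫ eqToHom (ft_pb X hX f).symm) ≫ q X hX f

namespace CSystem

variable {Ob : Type u} [CSystem.{u, v} Ob]

/-- `Ob_n(Γ)`: the objects `Δ` with `l(Δ) ≥ n + l(Γ)` and `ft^n(Δ) = Γ`. -/
@[ext]
structure ObOver (n : ℕ) (Γ : Ob) where
  obj : Ob
  le_len : n + len Γ ≤ len obj
  ft_iterate : ft^[n] obj = Γ

theorem ObOver.pos {n : ℕ} {Γ : Ob} (Δ : ObOver (n + 1) Γ) : 0 < len Δ.obj := by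
  have := Δ.le_len
  omega

/-- The father of an element of `Ob_{n+1}(Γ)`, as an element of `Ob_n(Γ)`. -/
@[reducible]
def ObOver.ft {n : ℕ} {Γ : Ob} (Δ : ObOver (n + 1) Γ) : ObOver n Γ where
  obj := CSystem.ft Δ.obj
  le_len := by
    have h1 := Δ.le_len
    have h2 := len_ft Δ.obj Δ.pos
    omega
  ft_iterate := Δ.ft_iterate

/-- An element of `Ob_{n+1}(Γ)` is an element of `Ob_1` of its father. -/
@[reducible]
def ObOver.last {n : ℕ} {Γ : Ob} (Δ : ObOver (n + 1) Γ) : ObOver 1 (CSystem.ft Δ.obj) where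
  obj := Δ.obj
  le_len := by
    have h1 := Δ.pos
    have h2 := len_ft Δ.obj Δ.pos
    omega
  ft_iterate := rfl

/-- For `f : Γ' ⟶ Γ` and `Δ ∈ Ob_n(Γ)`, the iterated canonical pull-back `f^*(Δ, n) ∈ Ob_n(Γ')`
together with the morphism `q(f, Δ, n) : f^*(Δ, n) ⟶ Δ`. One has `q(f, Γ, 0) = f`,
`f^*(Δ, n + 1) = q(f, ft Δ, n)^*(Δ)` and `q(f, Δ, n + 1) = q(q(f, ft Δ, n), Δ)`. -/
def pullData {Γ Γ' : Ob} (f : Γ' ⟶ Γ) :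
    (n : ℕ) → (Δ : ObOver n Γ) → Σ Δ' : ObOver n Γ', (Δ'.obj ⟶ Δ.obj)
  | 0, Δ => ⟨⟨Γ', by omega, rfl⟩, f ≫ eqToHom Δ.ft_iterate.symm⟩
  | n + 1, Δ =>
    ⟨{ obj := pb Δ.obj Δ.pos (pullData f n Δ.ft).2
       le_len := by
        have h1 := (pullData f n Δ.ft).1.le_len
        have h2 := len_ft _ (len_pb Δ.obj Δ.pos (pullData f n Δ.ft).2)
        have h3 := len_pb Δ.obj Δ.pos (pullData f n Δ.ft).2
        rw [ft_pb] at h2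
        omega
       ft_iterate := by
        have h1 := (pullData f n Δ.ft).1.ft_iterate
        rw [Function.iterate_succ_apply, ft_pb]
        exact h1 },
      q Δ.obj Δ.pos (pullData f n Δ.ft).2⟩

/-- `f^* : Ob_n(Γ) → Ob_n(Γ')`. -/
def ObOver.pull {n : ℕ} {Γ Γ' : Ob} (f : Γ' ⟶ Γ) (Δ : ObOver n Γ) : ObOver n Γ' :=
  (pullData f n Δ).1

variable (Ob) in
/-- The set `\widetilde{Ob}` of sections `sec : ft(Δ) ⟶ Δ` of the projections `p Δ`, over all
objects `Δ = ∂(sec)` of positive length. -/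
structure Tm where
  bd : Ob
  pos : 0 < len bd
  sec : ft bd ⟶ bd
  sec_p : sec ≫ p bd = 𝟙 (ft bd)

/-- For `s : ft(Δ) ⟶ Δ` a section and `g : Y ⟶ ft(Δ)`, the section `g^*(s)` of `p (g^*(Δ))`: the
unique one with `g^*(s) ≫ q(g, Δ) = g ≫ s` (up to the identification `ft (g^*(Δ)) = Y`). -/
noncomputable def Tm.pull (s : Tm Ob) {Y : Ob} (g : Y ⟶ ft s.bd) : Tm Ob where
  bd := pb s.bd s.pos g
  pos := len_pb s.bd s.pos g
  sec := eqToHom (ft_pb s.bd s.pos g) ≫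
    (isPullback s.bd s.pos g).lift (g ≫ s.sec) (𝟙 Y) (by simp [s.sec_p])
  sec_p := by
    have h := (isPullback s.bd s.pos g).lift_snd (g ≫ s.sec) (𝟙 Y) (by simp [s.sec_p])
    rw [← cancel_mono (eqToHom (ft_pb s.bd s.pos g))]
    simp only [Category.assoc, h, Category.comp_id, Category.id_comp]

/-- `\widetilde{Ob}_n(Γ)`: the sections `s` with `∂(s) ∈ Ob_n(Γ)`. -/
@[ext]
structure TmOver (n : ℕ) (Γ : Ob) where
  tm : Tm Ob
  le_len : n + len Γ ≤ len tm.bd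
  ft_iterate : ft^[n] tm.bd = Γ

/-- `∂ : \widetilde{Ob}_n(Γ) → Ob_n(Γ)`. -/
@[reducible]
def TmOver.bd {n : ℕ} {Γ : Ob} (s : TmOver n Γ) : ObOver n Γ := ⟨s.tm.bd, s.le_len, s.ft_iterate⟩

/-- `f^* : \widetilde{Ob}_{n+1}(Γ) → \widetilde{Ob}_{n+1}(Γ')`, which pulls back a section of
`p Δ` along `q(f, ft(Δ), n)`. -/
noncomputable def TmOver.pull {n : ℕ} {Γ Γ' : Ob} (f : Γ' ⟶ Γ) (s : TmOver (n + 1) Γ) :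
    TmOver (n + 1) Γ' where
  tm := s.tm.pull (pullData f n s.bd.ft).2
  le_len := (s.bd.pull f).le_len
  ft_iterate := (s.bd.pull f).ft_iterate

/-- An element of `\widetilde{Ob}_{n+1}(Γ)` is an element of `\widetilde{Ob}_1(ft(∂ s))`. -/
@[reducible]
def TmOver.last {n : ℕ} {Γ : Ob} (s : TmOver (n + 1) Γ) : TmOver 1 (CSystem.ft s.tm.bd) where
  tm := s.tm
  le_len := s.bd.last.le_len
  ft_iterate := rfl

variable (Ob) in
/-- A pre-`(Π, λ)`-structure on a C-system. -/
structure PrePiLambdaStructure where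
  Pi : ∀ Γ : Ob, ObOver 2 Γ → ObOver 1 Γ
  lam : ∀ Γ : Ob, TmOver 2 Γ → TmOver 1 Γ
  bd_lam : ∀ (Γ : Ob) (s : TmOver 2 Γ), (lam Γ s).bd = Pi Γ s.bd
  Pi_pull : ∀ {Γ Γ' : Ob} (f : Γ' ⟶ Γ) (T : ObOver 2 Γ), Pi Γ' (T.pull f) = (Pi Γ T).pull f
  lam_pull : ∀ {Γ Γ' : Ob} (f : Γ' ⟶ Γ) (s : TmOver 2 Γ), lam Γ' (s.pull f) = (lam Γ s).pull f

variable (Ob) in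
/-- A `(Π, λ)`-structure on a C-system: a pre-`(Π, λ)`-structure such that for all `Γ` the square
formed by `λ`, `∂`, `∂` and `Π` is a pull-back square of sets. -/
structure PiLambdaStructure extends PrePiLambdaStructure Ob where
  isPullback : ∀ (Γ : Ob) (T : ObOver 2 Γ) (r : TmOver 1 Γ), r.bd = Pi Γ T →
    ∃! s : TmOver 2 Γ, s.bd = T ∧ lam Γ s = r

end CSystem

/-! ### Universe categories and the C-system `CC(C, p)` -/

/-- A universe category structure on `C`: a chosen final object `pt` and a morphism `p : Ut ⟶ U`
with a chosen pull-back square for every `F : X ⟶ U`; `ext F` is `(X; F)`, `proj F` is `p_{X,F}`. -/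
structure UniverseStr (C : Type u) [Category.{v} C] where
  pt : C
  isTerminal : IsTerminal pt
  Ut : C
  U : C
  p : Ut ⟶ U
  ext : ∀ {X : C}, (X ⟶ U) → C
  proj : ∀ {X : C} (F : X ⟶ U), ext F ⟶ X
  Q : ∀ {X : C} (F : X ⟶ U), ext F ⟶ Ut
  isPullback : ∀ {X : C} (F : X ⟶ U), IsPullback (Q F) (proj F) p F

namespace UniverseStr

variable {C : Type u} [Category.{v} C] (𝒰 : UniverseStr C)

/-- `Q(f, F) : (X'; f ≫ F) ⟶ (X; F)`. -/
noncomputable def Qmor {X X' : C} (f : X' ⟶ X) (F : X ⟶ 𝒰.U) : 𝒰.ext (f ≫ F) ⟶ 𝒰.ext F :=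
  (𝒰.isPullback F).lift (𝒰.Q (f ≫ F)) (𝒰.proj (f ≫ F) ≫ f)
    (by rw [(𝒰.isPullback (f ≫ F)).w, Category.assoc])

/-- The pairs `(Ob_n, int_n : Ob_n → C)`: `Ob_0` is a point, `int_0 = pt`,
`Ob_{n+1} = ∐_{A ∈ Ob_n} Hom(int A, U)` and `int_{n+1}(A, F) = (int A; F)`. -/
def obInt : ℕ → Σ T : Type v, (T → C)
  | 0 => ⟨PUnit, fun _ => 𝒰.pt⟩
  | n + 1 => ⟨Σ A : (obInt n).1, ((obInt n).2 A ⟶ 𝒰.U), fun A => 𝒰.ext A.2⟩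

/-- The set of objects of `CC(C, p)`: pairs `(n, A)` with `A ∈ Ob_n`. -/
structure CC where
  len : ℕ
  obj : (𝒰.obInt len).1

namespace CC

variable {𝒰}

/-- The function `int : Ob(CC(C, p)) → C`. -/
def int (Γ : CC 𝒰) : C := (𝒰.obInt Γ.len).2 Γ.obj

/-- Morphisms `Γ ⟶ Γ'` in `CC(C, p)` are the morphisms `int Γ ⟶ int Γ'` in `C`. -/
instance category : Category.{v} (CC 𝒰) where
  Hom Γ Γ' := int Γ ⟶ int Γ'
  id Γ := 𝟙 (int Γ)
  comp f g := CategoryStruct.comp (obj := C) f g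
  id_comp f := Category.id_comp (obj := C) f
  comp_id f := Category.comp_id (obj := C) f
  assoc f g h := Category.assoc (obj := C) f g h

/-- The functor `int` on morphisms. -/
def intMap {Γ Γ' : CC 𝒰} (f : Γ ⟶ Γ') : int Γ ⟶ int Γ' := f

/-- The object `(n + 1, (A, F))` for `Γ = (n, A)` and `F : int Γ ⟶ U`. -/
def cons (Γ : CC 𝒰) (F : int Γ ⟶ 𝒰.U) : CC 𝒰 := ⟨Γ.len + 1, ⟨Γ.obj, F⟩⟩

def ft : CC 𝒰 → CC 𝒰
  | ⟨0, A⟩ => ⟨0, A⟩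
  | ⟨n + 1, ⟨A, _⟩⟩ => ⟨n, A⟩

/-- For `Γ = (n + 1, (A, F))`, the morphism `F : int(ft Γ) ⟶ U`. -/
def lastMap : (Γ : CC 𝒰) → 0 < Γ.len → (int (ft Γ) ⟶ 𝒰.U)
  | ⟨0, _⟩, h => absurd h (Nat.lt_irrefl 0)
  | ⟨_ + 1, ⟨_, F⟩⟩, _ => F

theorem eq_cons : ∀ (Γ : CC 𝒰) (h : 0 < Γ.len), Γ = cons (ft Γ) (lastMap Γ h)
  | ⟨0, _⟩, h => absurd h (Nat.lt_irrefl 0)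
  | ⟨_ + 1, ⟨_, _⟩⟩, _ => rfl

theorem int_eq (Γ : CC 𝒰) (h : 0 < Γ.len) : int Γ = 𝒰.ext (lastMap Γ h) :=
  congrArg int (eq_cons Γ h)

def proj : (Γ : CC 𝒰) → (Γ ⟶ ft Γ)
  | ⟨0, A⟩ => 𝟙 (int ⟨0, A⟩)
  | ⟨_ + 1, ⟨_, F⟩⟩ => 𝒰.proj F

/-- `f^*(X) = (m + 1, (B, f ≫ F))` for `X = (n + 1, (A, F))` and `f : (m, B) ⟶ (n, A)`. -/
def pb (X : CC 𝒰) (hX : 0 < X.len) {Y : CC 𝒰} (f : Y ⟶ ft X) : CC 𝒰 :=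
  cons Y (intMap f ≫ lastMap X hX)

/-- `q(f, X)` is `Q(f, F)` for `X = (n + 1, (A, F))`. -/
noncomputable def q : (X : CC 𝒰) → (hX : 0 < X.len) → {Y : CC 𝒰} → (f : Y ⟶ ft X) → (pb X hX f ⟶ X)
  | ⟨0, _⟩, h, _, _ => absurd h (Nat.lt_irrefl 0)
  | ⟨_ + 1, ⟨_, F⟩⟩, _, _, f => 𝒰.Qmor (intMap f) F

end CC

theorem Qmor_Q {X X' : C} (f : X' ⟶ X) (F : X ⟶ 𝒰.U) :
    𝒰.Qmor f F ≫ 𝒰.Q F = 𝒰.Q (f ≫ F) := (𝒰.isPullback F).lift_fst _ _ _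

theorem Qmor_proj {X X' : C} (f : X' ⟶ X) (F : X ⟶ 𝒰.U) :
    𝒰.Qmor f F ≫ 𝒰.proj F = 𝒰.proj (f ≫ F) ≫ f := (𝒰.isPullback F).lift_snd _ _ _

theorem Q_eqToHom {X : C} {F F' : X ⟶ 𝒰.U} (h : F = F') :
    eqToHom (congrArg 𝒰.ext h) ≫ 𝒰.Q F' = 𝒰.Q F := by
  subst h; simp

theorem proj_eqToHom {X : C} {F F' : X ⟶ 𝒰.U} (h : F = F') :
    eqToHom (congrArg 𝒰.ext h) ≫ 𝒰.proj F' = 𝒰.proj F := by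
  subst h; simp

theorem Qmor_comp {X X' X'' : C} (g : X'' ⟶ X') (f : X' ⟶ X) (F : X ⟶ 𝒰.U) :
    𝒰.Qmor (g ≫ f) F = eqToHom (congrArg 𝒰.ext (Category.assoc g f F)) ≫
      𝒰.Qmor g (f ≫ F) ≫ 𝒰.Qmor f F := by
  refine (𝒰.isPullback F).hom_ext ?_ ?_
  · simp only [Qmor_Q, Category.assoc]
    exact (𝒰.Q_eqToHom (Category.assoc g f F)).symm
  · simp only [Qmor_proj, Category.assoc]
    rw [← Category.assoc (𝒰.Qmor _ _), Qmor_proj, ← Category.assoc, ← Category.assoc,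
      ← Category.assoc, 𝒰.proj_eqToHom (Category.assoc g f F), Category.assoc]

theorem CC.eqToHom_cons (Γ : CC 𝒰) {F F' : CC.int Γ ⟶ 𝒰.U} (h : F = F') :
    eqToHom (congrArg (CC.cons Γ) h) = (eqToHom (congrArg 𝒰.ext h) : 𝒰.ext F ⟶ 𝒰.ext F') := by
  subst h; rfl

theorem Qmor_isPullback {X X' : C} (f : X' ⟶ X) (F : X ⟶ 𝒰.U) :
    IsPullback (𝒰.Qmor f F) (𝒰.proj (f ≫ F)) (𝒰.proj F) f := by
  refine IsPullback.of_right (h₁₂ := 𝒰.Q F) (v₁₃ := 𝒰.p) (h₂₂ := F) ?_ (𝒰.Qmor_proj f F)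
    (𝒰.isPullback F)
  rw [𝒰.Qmor_Q]
  exact 𝒰.isPullback (f ≫ F)

namespace CC

variable {𝒰}

/-- A pull-back square in `C` between objects of the form `int Γ` is one in `CC(C, p)`. -/
theorem isPullback_of_int {W X Y Z : CC 𝒰} {a : W ⟶ X} {b : W ⟶ Y} {c : X ⟶ Z} {d : Y ⟶ Z}
    (h : IsPullback (intMap a) (intMap b) (intMap c) (intMap d)) : IsPullback a b c d :=
  ⟨⟨h.w⟩, ⟨PullbackCone.IsLimit.mk (C := CC 𝒰) h.w
    (fun s => (h.lift (intMap s.fst) (intMap s.snd) s.condition : int s.pt ⟶ int W))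
    (fun s => h.lift_fst (intMap s.fst) (intMap s.snd) s.condition)
    (fun s => h.lift_snd (intMap s.fst) (intMap s.snd) s.condition)
    (fun s _ h₁ h₂ => h.hom_ext
      (h₁.trans (h.lift_fst (intMap s.fst) (intMap s.snd) s.condition).symm)
      (h₂.trans (h.lift_snd (intMap s.fst) (intMap s.snd) s.condition).symm))⟩⟩

theorem isPullback_q : ∀ (X : CC 𝒰) (hX : 0 < X.len) {Y : CC 𝒰}
    (f : Y ⟶ ft X), IsPullback (q X hX f) (proj (pb X hX f) ≫ eqToHom rfl) (proj X) f
  | ⟨0, _⟩, h, _, _ => absurd h (Nat.lt_irrefl 0)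
  | ⟨_ + 1, ⟨_, F⟩⟩, _, _, f => by
    rw [eqToHom_refl, Category.comp_id]
    exact isPullback_of_int (𝒰.Qmor_isPullback (intMap f) F)

theorem pb_id : ∀ (X : CC 𝒰) (hX : 0 < X.len), pb X hX (𝟙 (ft X)) = X
  | ⟨0, _⟩, h => absurd h (Nat.lt_irrefl 0)
  | ⟨n + 1, ⟨A, F⟩⟩, _ => congrArg (cons (𝒰 := 𝒰) ⟨n, A⟩) (Category.id_comp F)

theorem q_id : ∀ (X : CC 𝒰) (hX : 0 < X.len), q X hX (𝟙 (ft X)) = eqToHom (pb_id X hX)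
  | ⟨0, _⟩, h => absurd h (Nat.lt_irrefl 0)
  | ⟨n + 1, ⟨A, F⟩⟩, hX => by
    refine Eq.trans ?_ (eqToHom_cons 𝒰 ⟨n, A⟩ (Category.id_comp F)).symm
    refine (𝒰.isPullback F).hom_ext ?_ ?_
    · refine ((𝒰.Qmor_Q _ F).trans ?_)
      exact (𝒰.Q_eqToHom (Category.id_comp F)).symm
    · refine ((𝒰.Qmor_proj _ F).trans ?_)
      exact (Category.comp_id _).trans (𝒰.proj_eqToHom (Category.id_comp F)).symm

theorem len_pb (X : CC 𝒰) (hX : 0 < X.len) {Y : CC 𝒰} (f : Y ⟶ ft X) : 0 < (pb X hX f).len :=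
  Nat.succ_pos Y.len

theorem pb_comp : ∀ (X : CC 𝒰) (hX : 0 < X.len) {Y Z : CC 𝒰} (f : Y ⟶ ft X) (g : Z ⟶ Y),
    pb X hX (g ≫ f) = pb (pb X hX f) (len_pb X hX f) (g ≫ eqToHom rfl) := by
  intro X hX Y Z f g
  have h := Category.comp_id g
  exact (congrArg (cons Z) (Category.assoc (intMap g) (intMap f) (lastMap X hX))).trans
    (congrArg (fun g' : Z ⟶ Y => pb (pb X hX f) (len_pb X hX f) g') h.symm)

theorem q_comp_cons (Γ : CC 𝒰) (F : int Γ ⟶ 𝒰.U) (h0 : 0 < (cons Γ F).len) {Y Z : CC 𝒰}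
    (f : Y ⟶ Γ) (g g' : Z ⟶ Y) (hg : g' = g)
    (e : pb (cons Γ F) h0 (g ≫ f) = pb (pb (cons Γ F) h0 f) (len_pb (cons Γ F) h0 f) g') :
    q (cons Γ F) h0 (g ≫ f) = eqToHom e ≫
      q (pb (cons Γ F) h0 f) (len_pb (cons Γ F) h0 f) g' ≫ q (cons Γ F) h0 f := by
  subst hg
  have e' := Category.assoc (intMap g') (intMap f) F
  have h2 : eqToHom e = (eqToHom (congrArg 𝒰.ext e') :
      𝒰.ext ((intMap g' ≫ intMap f) ≫ F) ⟶ 𝒰.ext (intMap g' ≫ intMap f ≫ F)) :=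
    eqToHom_cons 𝒰 Z e'
  rw [h2]
  exact 𝒰.Qmor_comp (intMap g') (intMap f) F

theorem q_comp : ∀ (X : CC 𝒰) (hX : 0 < X.len) {Y Z : CC 𝒰} (f : Y ⟶ ft X) (g : Z ⟶ Y),
    q X hX (g ≫ f) = eqToHom (pb_comp X hX f g) ≫
      q (pb X hX f) (len_pb X hX f) (g ≫ eqToHom rfl) ≫ q X hX f
  | ⟨0, _⟩, h, _, _, _, _ => absurd h (Nat.lt_irrefl 0)
  | ⟨n + 1, ⟨A, F⟩⟩, hX, _, _, f, g =>
    q_comp_cons (𝒰 := 𝒰) ⟨n, A⟩ F hX f g _ (Category.comp_id g) _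

theorem ft_eq_of_len : ∀ X : CC 𝒰, 0 < X.len → (ft X).len = X.len - 1
  | ⟨0, _⟩, h => absurd h (Nat.lt_irrefl 0)
  | ⟨_ + 1, ⟨_, _⟩⟩, _ => rfl

theorem len_eq_zero_iff : ∀ X : CC 𝒰, X.len = 0 ↔ X = ⟨0, PUnit.unit⟩
  | ⟨0, _⟩ => ⟨fun _ => rfl, fun _ => rfl⟩
  | ⟨n + 1, _⟩ => ⟨fun h => absurd h (Nat.succ_ne_zero n), fun h => congrArg CC.len h⟩

/-- The C-system `CC(C, p)`. -/
noncomputable instance cSystem : CSystem.{v, v} (CC 𝒰) where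
  len := CC.len
  pt := ⟨0, PUnit.unit⟩
  ft := ft
  p := proj
  pb X hX _ f := pb X hX f
  q X hX _ f := q X hX f
  len_eq_zero_iff := len_eq_zero_iff
  len_ft := ft_eq_of_len
  ft_pt := rfl
  isTerminal := ⟨IsTerminal.ofUniqueHom (fun Γ => (𝒰.isTerminal.from (int Γ) : int Γ ⟶ 𝒰.pt))
    (fun _ m => 𝒰.isTerminal.hom_ext (intMap m) _)⟩
  len_pb := len_pb
  ft_pb _ _ _ _ := rfl
  isPullback X hX _ f := isPullback_q X hX f
  pb_id := pb_id
  q_id := q_id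
  pb_comp X hX _ _ f g := pb_comp X hX f g
  q_comp X hX _ _ f g := q_comp X hX f g

/-! #### The bijections `u_1`, `\widetilde u_1`, `u_2` and `\widetilde u_2` -/

open CSystem

/-- The element `(n + 1, (A, F))` of `Ob_1(Γ)` for `Γ = (n, A)`. -/
def consOver (Γ : CC 𝒰) (F : int Γ ⟶ 𝒰.U) : ObOver 1 Γ where
  obj := cons Γ F
  le_len := (Nat.add_comm 1 Γ.len).le
  ft_iterate := rfl

/-- The element of `\widetilde{Ob}_1(Γ)` given by a section of `p_{int Γ, F}`. -/
def sectionOver (Γ : CC 𝒰) (F : int Γ ⟶ 𝒰.U) (s : int Γ ⟶ 𝒰.ext F)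
    (hs : s ≫ 𝒰.proj F = 𝟙 (int Γ)) : TmOver 1 Γ where
  tm := { bd := cons Γ F, pos := Nat.succ_pos Γ.len, sec := s, sec_p := hs }
  le_len := (Nat.add_comm 1 Γ.len).le
  ft_iterate := rfl

theorem sectionOver_congr {Γ : CC 𝒰} {F F' : int Γ ⟶ 𝒰.U} {s : int Γ ⟶ 𝒰.ext F}
    {hs : s ≫ 𝒰.proj F = 𝟙 (int Γ)} {s' : int Γ ⟶ 𝒰.ext F'}
    {hs' : s' ≫ 𝒰.proj F' = 𝟙 (int Γ)} (hF : F = F') (h : s ≫ 𝒰.Q F = s' ≫ 𝒰.Q F') :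
    sectionOver Γ F s hs = sectionOver Γ F' s' hs' := by
  subst hF
  have : s = s' := (𝒰.isPullback F).hom_ext h (hs.trans hs'.symm)
  subst this
  rfl

theorem exists_eq_consOver {Γ : CC 𝒰} (T : ObOver 1 Γ) : ∃ F, T = consOver Γ F := by
  obtain ⟨⟨_ | n, B⟩, h1, h2⟩ := T
  · exact absurd (show 1 + Γ.len ≤ 0 from h1) (by omega)
  · obtain ⟨A, F⟩ := B
    obtain rfl : (⟨n, A⟩ : CC 𝒰) = Γ := h2
    exact ⟨F, rfl⟩

theorem exists_eq_sectionOver {Γ : CC 𝒰} (o : TmOver 1 Γ) :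
    ∃ F s hs, o = sectionOver Γ F s hs := by
  obtain ⟨⟨⟨_ | n, B⟩, h0, s, hs⟩, h1, h2⟩ := o
  · exact absurd (show 0 < 0 from h0) (Nat.lt_irrefl 0)
  · obtain ⟨A, F⟩ := B
    obtain rfl : (⟨n, A⟩ : CC 𝒰) = Γ := h2
    exact ⟨F, s, hs, rfl⟩

/-- `u_{1,Γ} : Ob_1(Γ) → Hom(int Γ, U)`, which sends `(n + 1, (A, F))` to `F`. -/
noncomputable def u₁ (Γ : CC 𝒰) : ObOver 1 Γ ≃ (int Γ ⟶ 𝒰.U) where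
  toFun T := eqToHom (congrArg int T.ft_iterate).symm ≫ lastMap T.obj T.pos
  invFun := consOver Γ
  left_inv T := by
    obtain ⟨F, rfl⟩ := exists_eq_consOver T
    exact congrArg (consOver Γ) (Category.id_comp F)
  right_inv F := Category.id_comp F

/-- `int(Γ') = (int Γ; u_1(Γ'))` for `Γ' ∈ Ob_1(Γ)`. -/
theorem int_eq_ext {Γ : CC 𝒰} (T : ObOver 1 Γ) : int T.obj = 𝒰.ext (u₁ Γ T) := by
  obtain ⟨F, rfl⟩ := exists_eq_consOver T
  exact congrArg 𝒰.ext (Category.id_comp F).symm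

/-- `o ↦ int(o) ≫ Q(u_1(∂ o))` for `o ∈ \widetilde{Ob}_1(Γ)`. -/
noncomputable def uTildeFun (Γ : CC 𝒰) (o : TmOver 1 Γ) : int Γ ⟶ 𝒰.Ut :=
  eqToHom (congrArg int o.ft_iterate).symm ≫ intMap o.tm.sec ≫
    eqToHom (int_eq_ext o.bd) ≫ 𝒰.Q (u₁ Γ o.bd)

theorem uTildeFun_sectionOver (Γ : CC 𝒰) (F : int Γ ⟶ 𝒰.U) (s : int Γ ⟶ 𝒰.ext F)
    (hs : s ≫ 𝒰.proj F = 𝟙 (int Γ)) : uTildeFun Γ (sectionOver Γ F s hs) = s ≫ 𝒰.Q F := by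
  refine (Category.id_comp _).trans ?_
  exact congrArg (fun t => s ≫ t) (𝒰.Q_eqToHom (Category.id_comp F).symm)

/-- `\widetilde u_{1,Γ} : \widetilde{Ob}_1(Γ) → Hom(int Γ, \widetilde U)`,
`o ↦ int(o) ≫ Q(u_1(∂ o))`. -/
noncomputable def uTilde₁ (Γ : CC 𝒰) : TmOver 1 Γ ≃ (int Γ ⟶ 𝒰.Ut) where
  toFun := uTildeFun Γ
  invFun f := sectionOver Γ (f ≫ 𝒰.p)
    ((𝒰.isPullback (f ≫ 𝒰.p)).lift f (𝟙 (int Γ)) (Category.id_comp _).symm)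
    ((𝒰.isPullback (f ≫ 𝒰.p)).lift_snd _ _ _)
  left_inv o := by
    obtain ⟨F, s, hs, rfl⟩ := exists_eq_sectionOver o
    refine sectionOver_congr ?_ ?_
    · rw [uTildeFun_sectionOver, Category.assoc, (𝒰.isPullback F).w, ← Category.assoc, hs,
        Category.id_comp]
    · rw [IsPullback.lift_fst, uTildeFun_sectionOver]
  right_inv f := by
    rw [uTildeFun_sectionOver, IsPullback.lift_fst]

end CC

/-- `D_p(X, V) = ∐_{F : X ⟶ U} Hom((X; F), V)`. -/
@[reducible]
def Dp (X V : C) : Type v := Σ F : X ⟶ 𝒰.U, (𝒰.ext F ⟶ V)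

theorem Dp_ext {X V : C} {F F' : X ⟶ 𝒰.U} {G : 𝒰.ext F ⟶ V} {G' : 𝒰.ext F' ⟶ V} (h : F = F')
    (hG : G = eqToHom (congrArg 𝒰.ext h) ≫ G') : (⟨F, G⟩ : 𝒰.Dp X V) = ⟨F', G'⟩ := by
  subst h
  rw [hG, eqToHom_refl, Category.id_comp]

namespace CC

open CSystem

variable {𝒰}

theorem consOver₂_aux {Γ : CC 𝒰} (T : ObOver 2 Γ) : ∃ F G,
    T = ⟨cons (cons Γ F) G, (Nat.add_comm 2 Γ.len).le, rfl⟩ := by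
  obtain ⟨⟨_ | _ | n, B⟩, h1, h2⟩ := T
  · exact absurd (show 2 + Γ.len ≤ 0 from h1) (by omega)
  · exact absurd (show 2 + Γ.len ≤ 1 from h1) (by omega)
  · obtain ⟨⟨A, F⟩, G⟩ := B
    obtain rfl : (⟨n, A⟩ : CC 𝒰) = Γ := h2
    exact ⟨F, G, rfl⟩

theorem sectionOver₂_aux {Γ : CC 𝒰} (o : TmOver 2 Γ) : ∃ F, ∃ o' : TmOver 1 (cons Γ F),
    ∃ h1 h2, o = ⟨o'.tm, h1, h2⟩ := by
  obtain ⟨⟨⟨_ | _ | n, B⟩, h0, s, hs⟩, h1, h2⟩ := o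
  · exact absurd (show 2 + Γ.len ≤ 0 from h1) (by omega)
  · exact absurd (show 2 + Γ.len ≤ 1 from h1) (by omega)
  · obtain ⟨⟨A, F⟩, G⟩ := B
    obtain rfl : (⟨n, A⟩ : CC 𝒰) = Γ := h2
    exact ⟨F, sectionOver (cons ⟨n, A⟩ F) G s hs, h1, rfl, rfl⟩

/-- The inverse of `u_{2,Γ}`. -/
def uInv₂ (Γ : CC 𝒰) (d : 𝒰.Dp (int Γ) 𝒰.U) : ObOver 2 Γ :=
  ⟨cons (cons Γ d.1) d.2, (Nat.add_comm 2 Γ.len).le, rfl⟩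

/-- `T ↦ (u_{1,Γ}(ft T), u_{1,ft T}(T))` for `T ∈ Ob_2(Γ)`. -/
noncomputable def uFun₂ (Γ : CC 𝒰) (T : ObOver 2 Γ) : 𝒰.Dp (int Γ) 𝒰.U :=
  ⟨u₁ Γ T.ft, eqToHom (int_eq_ext T.ft).symm ≫ u₁ (CSystem.ft T.obj) T.last⟩

theorem uFun₂_uInv₂ (Γ : CC 𝒰) (d : 𝒰.Dp (int Γ) 𝒰.U) : uFun₂ Γ (uInv₂ Γ d) = d :=
  𝒰.Dp_ext (Category.id_comp d.1)
    (congrArg (fun t => eqToHom (congrArg 𝒰.ext (Category.id_comp d.1)) ≫ t)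
      (Category.id_comp d.2))

/-- `u_{2,Γ} : Ob_2(Γ) → D_p(int Γ, U)`. -/
noncomputable def u₂ (Γ : CC 𝒰) : ObOver 2 Γ ≃ 𝒰.Dp (int Γ) 𝒰.U where
  toFun := uFun₂ Γ
  invFun := uInv₂ Γ
  left_inv T := by
    obtain ⟨F, G, hT⟩ := consOver₂_aux T
    obtain rfl : T = uInv₂ Γ ⟨F, G⟩ := hT
    rw [uFun₂_uInv₂]
  right_inv := uFun₂_uInv₂ Γ

/-- The inverse of `\widetilde u_{2,Γ}`. -/
noncomputable def uTildeInv₂ (Γ : CC 𝒰) (d : 𝒰.Dp (int Γ) 𝒰.Ut) : TmOver 2 Γ where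
  tm := ((uTilde₁ (cons Γ d.1)).symm d.2).tm
  le_len := (Nat.add_comm 2 Γ.len).le
  ft_iterate := rfl

/-- `o ↦ (u_{1,Γ}(ft(∂ o)), \widetilde u_{1,ft(∂ o)}(o))` for `o ∈ \widetilde{Ob}_2(Γ)`. -/
noncomputable def uTildeFun₂ (Γ : CC 𝒰) (o : TmOver 2 Γ) : 𝒰.Dp (int Γ) 𝒰.Ut :=
  ⟨u₁ Γ o.bd.ft, eqToHom (int_eq_ext o.bd.ft).symm ≫ uTilde₁ (CSystem.ft o.tm.bd) o.last⟩

theorem uTildeFun₂_uTildeInv₂ (Γ : CC 𝒰) (d : 𝒰.Dp (int Γ) 𝒰.Ut) :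
    uTildeFun₂ Γ (uTildeInv₂ Γ d) = d :=
  𝒰.Dp_ext (Category.id_comp d.1)
    (congrArg (fun t => eqToHom (congrArg 𝒰.ext (Category.id_comp d.1)) ≫ t)
      ((uTilde₁ (cons Γ d.1)).apply_symm_apply d.2))

/-- `\widetilde u_{2,Γ} : \widetilde{Ob}_2(Γ) → D_p(int Γ, \widetilde U)`. -/
noncomputable def uTilde₂ (Γ : CC 𝒰) : TmOver 2 Γ ≃ 𝒰.Dp (int Γ) 𝒰.Ut where
  toFun := uTildeFun₂ Γ
  invFun := uTildeInv₂ Γ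
  left_inv o := by
    obtain ⟨F, o', h1, h2, rfl⟩ := sectionOver₂_aux o
    have h : (⟨o'.tm, h1, h2⟩ : TmOver 2 Γ) = uTildeInv₂ Γ ⟨F, uTilde₁ (cons Γ F) o'⟩ :=
      TmOver.ext (congrArg (fun t : TmOver 1 (cons Γ F) => t.tm) ((uTilde₁ (cons Γ F)).symm_apply_apply o').symm)
    rw [h, uTildeFun₂_uTildeInv₂]
  right_inv := uTildeFun₂_uTildeInv₂ Γ

end CC

end UniverseStr

/-! ### Locally cartesian closed structures and the functor `I_p` -/

/-- A structure of a category with fiber products: a chosen fiber square for every `f : X ⟶ Z`,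
`g : Y ⟶ Z`. -/
structure FiberProducts (C : Type u) [Category.{v} C] where
  prod : ∀ {X Y Z : C}, (X ⟶ Z) → (Y ⟶ Z) → C
  pr₁ : ∀ {X Y Z : C} (f : X ⟶ Z) (g : Y ⟶ Z), prod f g ⟶ X
  pr₂ : ∀ {X Y Z : C} (f : X ⟶ Z) (g : Y ⟶ Z), prod f g ⟶ Y
  isPullback : ∀ {X Y Z : C} (f : X ⟶ Z) (g : Y ⟶ Z), IsPullback (pr₁ f g) (pr₂ f g) f g

namespace FiberProducts

variable {C : Type u} [Category.{v} C] (S : FiberProducts C)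

/-- `a × b : (X', f') ×_Z (Y', g') ⟶ (X, f) ×_Z (Y, g)` for `a : X' ⟶ X` and `b : Y' ⟶ Y`
over `Z`. -/
noncomputable def map {X Y X' Y' Z : C} {f : X ⟶ Z} {g : Y ⟶ Z} {f' : X' ⟶ Z} {g' : Y' ⟶ Z}
    (a : X' ⟶ X) (b : Y' ⟶ Y) (ha : a ≫ f = f') (hb : b ≫ g = g') : S.prod f' g' ⟶ S.prod f g :=
  (S.isPullback f g).lift (S.pr₁ f' g' ≫ a) (S.pr₂ f' g' ≫ b)
    (by rw [Category.assoc, Category.assoc, ha, hb, (S.isPullback f' g').w])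

end FiberProducts

/-- A locally cartesian closed structure on a category. For `f : X ⟶ Z` and `g : Y ⟶ Z`,
`hom f g` is the object `\underline{Hom}_Z((X, f), (Y, g))` and `tri f g` its morphism to `Z`. -/
structure LCCStr (C : Type u) [Category.{v} C] extends FiberProducts C where
  hom : ∀ {X Y Z : C}, (X ⟶ Z) → (Y ⟶ Z) → C
  tri : ∀ {X Y Z : C} (f : X ⟶ Z) (g : Y ⟶ Z), hom f g ⟶ Z
  homMap : ∀ {X Y Y' Z : C} (f : X ⟶ Z) {g : Y ⟶ Z} {g' : Y' ⟶ Z} (a : Y ⟶ Y'),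
    a ≫ g' = g → (hom f g ⟶ hom f g')
  homMap_tri : ∀ {X Y Y' Z : C} (f : X ⟶ Z) {g : Y ⟶ Z} {g' : Y' ⟶ Z} (a : Y ⟶ Y')
    (ha : a ≫ g' = g), homMap f a ha ≫ tri f g' = tri f g
  homMap_id : ∀ {X Y Z : C} (f : X ⟶ Z) (g : Y ⟶ Z),
    homMap f (𝟙 Y) (Category.id_comp g) = 𝟙 (hom f g)
  homMap_comp : ∀ {X Y Y' Y'' Z : C} (f : X ⟶ Z) {g : Y ⟶ Z} {g' : Y' ⟶ Z} {g'' : Y'' ⟶ Z}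
    (a : Y ⟶ Y') (b : Y' ⟶ Y'') (ha : a ≫ g' = g) (hb : b ≫ g'' = g'),
    homMap f (a ≫ b) (by rw [Category.assoc, hb, ha]) = homMap f a ha ≫ homMap f b hb
  ev : ∀ {X Y Z : C} (f : X ⟶ Z) (g : Y ⟶ Z), prod (tri f g) f ⟶ Y
  ev_over : ∀ {X Y Z : C} (f : X ⟶ Z) (g : Y ⟶ Z), ev f g ≫ g = pr₁ (tri f g) f ≫ tri f g
  /-- `ev` is natural in `(Y, g)`. -/
  ev_natural : ∀ {X Y Y' Z : C} (f : X ⟶ Z) {g : Y ⟶ Z} {g' : Y' ⟶ Z} (a : Y ⟶ Y')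
    (ha : a ≫ g' = g), toFiberProducts.map (homMap f a ha) (𝟙 X) (homMap_tri f a ha)
      (Category.id_comp f) ≫ ev f g' = ev f g ≫ a
  /-- For all `h : W ⟶ Z`, the map `u ↦ (u × Id_X) ≫ ev` is a bijection from the morphisms
  `W ⟶ hom f g` over `Z` to the morphisms `(W, h) ×_Z (X, f) ⟶ Y` over `Z`. -/
  adj : ∀ {W X Y Z : C} (h : W ⟶ Z) (f : X ⟶ Z) (g : Y ⟶ Z)
    (v : prod h f ⟶ Y), v ≫ g = pr₁ h f ≫ h →
    ∃! u : W ⟶ hom f g, ∃ hu : u ≫ tri f g = h,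
      toFiberProducts.map u (𝟙 X) hu (Category.id_comp f) ≫ ev f g = v

namespace LCCStr

variable {C : Type u} [Category.{v} C] (L : LCCStr C) (𝒰 : UniverseStr C)

/-- `X × Y`, the fiber product over the final object `pt`. -/
@[reducible]
def times (X Y : C) : C := L.prod (𝒰.isTerminal.from X) (𝒰.isTerminal.from Y)

/-- `pr_1 : X × Y ⟶ X`. -/
@[reducible]
def fst (X Y : C) : L.times 𝒰 X Y ⟶ X := L.pr₁ _ _

/-- `pr_2 : X × Y ⟶ Y`. -/
@[reducible]
def snd (X Y : C) : L.times 𝒰 X Y ⟶ Y := L.pr₂ _ _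

/-- `Id_X × b : X × Y ⟶ X × Y'`. -/
noncomputable def idTimes (X : C) {Y Y' : C} (b : Y ⟶ Y') : L.times 𝒰 X Y ⟶ L.times 𝒰 X Y' :=
  L.map (𝟙 X) b (Category.id_comp _) (𝒰.isTerminal.hom_ext _ _)

theorem idTimes_fst (X : C) {Y Y' : C} (b : Y ⟶ Y') :
    L.idTimes 𝒰 X b ≫ L.fst 𝒰 X Y' = L.fst 𝒰 X Y :=
  ((L.isPullback _ _).lift_fst _ _ _).trans (Category.comp_id _)

/-- `I_p(V) = \underline{Hom}_U((\widetilde U, p), (U × V, pr_1))`. -/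
@[reducible]
def Ip (V : C) : C := L.hom 𝒰.p (L.fst 𝒰 𝒰.U V)

/-- `prI_p(V) : I_p(V) ⟶ U`. -/
@[reducible]
def prIp (V : C) : L.Ip 𝒰 V ⟶ 𝒰.U := L.tri 𝒰.p (L.fst 𝒰 𝒰.U V)

/-- `I_p(b) : I_p(V) ⟶ I_p(V')` for `b : V ⟶ V'`. -/
noncomputable def IpMap {V V' : C} (b : V ⟶ V') : L.Ip 𝒰 V ⟶ L.Ip 𝒰 V' :=
  L.homMap 𝒰.p (L.idTimes 𝒰 𝒰.U b) (L.idTimes_fst 𝒰 𝒰.U b)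

/-- `ι_F : (X; F) ⟶ (X, F) ×_U (\widetilde U, p)`. -/
noncomputable def iota {X : C} (F : X ⟶ 𝒰.U) : 𝒰.ext F ⟶ L.prod F 𝒰.p :=
  (L.isPullback F 𝒰.p).lift (𝒰.proj F) (𝒰.Q F) (𝒰.isPullback F).w.symm

/-- `st_p(V) = ι ≫ ev ≫ pr_2 : (I_p(V); prI_p(V)) ⟶ V`. -/
noncomputable def st (V : C) : 𝒰.ext (L.prIp 𝒰 V) ⟶ V :=
  L.iota 𝒰 (L.prIp 𝒰 V) ≫ L.ev 𝒰.p (L.fst 𝒰 𝒰.U V) ≫ L.snd 𝒰 𝒰.U V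

/-- `η^! : Hom(X, I_p(V)) → D_p(X, V)`, `g ↦ (g ≫ prI_p(V), Q(g, prI_p(V)) ≫ st_p(V))`. -/
noncomputable def etaInv (X V : C) (g : X ⟶ L.Ip 𝒰 V) : 𝒰.Dp X V :=
  ⟨g ≫ L.prIp 𝒰 V, 𝒰.Qmor g (L.prIp 𝒰 V) ≫ L.st 𝒰 V⟩

theorem Qmor_iota {X Y : C} (g : X ⟶ Y) (F : Y ⟶ 𝒰.U) :
    𝒰.Qmor g F ≫ L.iota 𝒰 F =
      L.iota 𝒰 (g ≫ F) ≫ L.map g (𝟙 𝒰.Ut) rfl (Category.id_comp 𝒰.p) := by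
  refine (L.isPullback F 𝒰.p).hom_ext ?_ ?_
  · simp only [iota, FiberProducts.map, Category.assoc, IsPullback.lift_fst,
      IsPullback.lift_fst_assoc, 𝒰.Qmor_proj]
  · simp only [iota, FiberProducts.map, Category.assoc, IsPullback.lift_snd,
      𝒰.Qmor_Q, Category.comp_id]

theorem isIso_iota {X : C} (F : X ⟶ 𝒰.U) : IsIso (L.iota 𝒰 F) := by
  have h : L.iota 𝒰 F =
      ((𝒰.isPullback F).flip.isoIsPullback _ _ (L.isPullback F 𝒰.p)).hom := by
    refine (L.isPullback F 𝒰.p).hom_ext ?_ ?_ <;> simp [iota]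
  rw [h]
  infer_instance

theorem etaInv_bijective (X V : C) : Function.Bijective (L.etaInv 𝒰 X V) := by
  have key : ∀ F : X ⟶ 𝒰.U, ∀ G : 𝒰.ext F ⟶ V, ∃! g : X ⟶ L.Ip 𝒰 V, L.etaInv 𝒰 X V g = ⟨F, G⟩ := by
    intro F G
    have hiso := L.isIso_iota 𝒰 F
    have hev : ∀ (g : X ⟶ L.Ip 𝒰 V) (hg : g ≫ L.prIp 𝒰 V = F),
        (L.map g (𝟙 𝒰.Ut) hg (Category.id_comp 𝒰.p) ≫ L.ev 𝒰.p (L.fst 𝒰 𝒰.U V)) ≫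
          L.fst 𝒰 𝒰.U V = L.pr₁ F 𝒰.p ≫ F := by
      intro g hg
      rw [Category.assoc, L.ev_over, FiberProducts.map, IsPullback.lift_fst_assoc, Category.assoc]
      exact congrArg (fun t => L.pr₁ F 𝒰.p ≫ t) hg
    let v : L.prod F 𝒰.p ⟶ L.times 𝒰 𝒰.U V :=
      (L.isPullback (𝒰.isTerminal.from 𝒰.U) (𝒰.isTerminal.from V)).lift (L.pr₁ F 𝒰.p ≫ F)
        (inv (L.iota 𝒰 F) ≫ G) (𝒰.isTerminal.hom_ext _ _)
    have hv1 : v ≫ L.fst 𝒰 𝒰.U V = L.pr₁ F 𝒰.p ≫ F := IsPullback.lift_fst _ _ _ _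
    have hv2 : v ≫ L.snd 𝒰 𝒰.U V = inv (L.iota 𝒰 F) ≫ G := IsPullback.lift_snd _ _ _ _
    obtain ⟨u, ⟨hu, huv⟩, huniq⟩ := L.adj F 𝒰.p (L.fst 𝒰 𝒰.U V) v hv1
    refine ⟨u, ?_, ?_⟩
    · change u ≫ L.prIp 𝒰 V = F at hu
      subst hu
      refine congrArg (Sigma.mk _) ?_
      have h1 := L.Qmor_iota 𝒰 u (L.prIp 𝒰 V)
      have h2 : L.map u (𝟙 𝒰.Ut) rfl (Category.id_comp 𝒰.p) ≫ L.ev 𝒰.p (L.fst 𝒰 𝒰.U V) ≫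
          L.snd 𝒰 𝒰.U V = inv (L.iota 𝒰 (u ≫ L.prIp 𝒰 V)) ≫ G := by
        rw [← hv2, ← huv, Category.assoc]
      rw [st, ← Category.assoc, h1, Category.assoc, h2, IsIso.hom_inv_id_assoc]
    · intro g hg
      obtain rfl : g ≫ L.prIp 𝒰 V = F := congrArg Sigma.fst hg
      have hG : 𝒰.Qmor g (L.prIp 𝒰 V) ≫ L.st 𝒰 V = G := eq_of_heq (Sigma.mk.inj hg).2
      refine huniq g ⟨rfl, ?_⟩
      refine (L.isPullback (𝒰.isTerminal.from 𝒰.U) (𝒰.isTerminal.from V)).hom_ext ?_ ?_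
      · exact (hev g rfl).trans hv1.symm
      · refine Eq.trans ?_ hv2.symm
        rw [IsIso.eq_inv_comp, ← hG, st, ← Category.assoc, ← Category.assoc, ← Category.assoc,
          ← L.Qmor_iota 𝒰 g (L.prIp 𝒰 V)]
        simp only [Category.assoc]
  constructor
  · intro g g' h
    obtain ⟨_, _, hu⟩ := key (L.etaInv 𝒰 X V g').1 (L.etaInv 𝒰 X V g').2
    exact (hu g h).trans (hu g' rfl).symm
  · rintro ⟨F, G⟩
    exact (key F G).exists

/-- The bijection `η_{X,V} : D_p(X, V) → Hom(X, I_p(V))`, the inverse of `η^!`. -/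
noncomputable def eta (X V : C) : 𝒰.Dp X V ≃ (X ⟶ L.Ip 𝒰 V) :=
  (Equiv.ofBijective (L.etaInv 𝒰 X V) (L.etaInv_bijective 𝒰 X V)).symm

open CSystem UniverseStr

/-- `μ_{2,Γ} : Ob_2(Γ) → Hom(int Γ, I_p(U))`, the composite of `u_{2,Γ}` and `η`. -/
noncomputable def mu₂ (Γ : CC 𝒰) : ObOver 2 Γ ≃ (CC.int Γ ⟶ L.Ip 𝒰 𝒰.U) :=
  (CC.u₂ Γ).trans (L.eta 𝒰 (CC.int Γ) 𝒰.U)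

/-- `\widetilde μ_{2,Γ} : \widetilde{Ob}_2(Γ) → Hom(int Γ, I_p(\widetilde U))`, the composite of
`\widetilde u_{2,Γ}` and `η`. -/
noncomputable def muTilde₂ (Γ : CC 𝒰) : TmOver 2 Γ ≃ (CC.int Γ ⟶ L.Ip 𝒰 𝒰.Ut) :=
  (CC.uTilde₂ Γ).trans (L.eta 𝒰 (CC.int Γ) 𝒰.Ut)

/-- A `Π`-structure on `p`: morphisms `Pt : I_p(\widetilde U) ⟶ \widetilde U` and
`P : I_p(U) ⟶ U` that form a pull-back square with `I_p(p)` and `p`. -/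
structure PiStr where
  Pt : L.Ip 𝒰 𝒰.Ut ⟶ 𝒰.Ut
  P : L.Ip 𝒰 𝒰.U ⟶ 𝒰.U
  isPullback : IsPullback Pt (L.IpMap 𝒰 𝒰.p) 𝒰.p P

end LCCStr

/-!
All the sets in question are representable. The bijections `u₁`, `uTilde₁`, `mu₂`, `muTilde₂`
identify `Ob_1(Γ)`, `\widetilde{Ob}_1(Γ)`, `Ob_2(Γ)`, `\widetilde{Ob}_2(Γ)` with the sets of
morphisms from `int Γ` to `U`, `Ut`, `I_p(U)`, `I_p(Ut)`. Under these identifications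

* the canonical pull-back along `f` is precomposition with `f` (`u₁_pull`, `uTilde₁_pull`,
  `mu₂_pull`, `muTilde₂_pull`);
* the boundary `∂` is postcomposition with `p` on `\widetilde{Ob}_1` (`u₁_bd`) and with `I_p(p)` on
  `\widetilde{Ob}_2` (`mu₂_bd`).

Hence `Π` and `λ` become postcomposition with `P` and with `Pt`. These commute with precomposition,
the square of sets for `Γ` is the image of the square of the `Π`-structure under `Hom(int Γ, -)`, and
this functor preserves pull-back squares.
-/

open CategoryTheory CategoryTheory.Limits

/-- The equation `f^*(s) ≫ q(f, Δ) = f ≫ s` that characterises the pull-back of a section `s` of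
`p Δ`. -/
theorem CSystem.Tm.pull_sec_q {Ob : Type u} [CSystem.{u, v} Ob] (s : Tm Ob) {Y : Ob}
    (f : Y ⟶ ft s.bd) :
    (s.pull f).sec ≫ q s.bd s.pos f = eqToHom (ft_pb s.bd s.pos f) ≫ f ≫ s.sec :=
  (Category.assoc _ _ _).trans
    (congrArg (_ ≫ ·) ((CSystem.isPullback s.bd s.pos f).lift_fst _ _ _))

namespace UniverseStr

variable {C : Type u} [Category.{v} C]

/-! ### Functoriality of `D_p` -/

section Dp

variable (𝒰 : UniverseStr C)

/-- `D_p(f, V) : D_p(X, V) → D_p(X', V)` for `f : X' ⟶ X`. -/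
noncomputable def Dp.pull {X X' V : C} (f : X' ⟶ X) (d : 𝒰.Dp X V) : 𝒰.Dp X' V :=
  ⟨f ≫ d.1, 𝒰.Qmor f d.1 ≫ d.2⟩

/-- `D_p(X, b) : D_p(X, V) → D_p(X, V')` for `b : V ⟶ V'`. -/
def Dp.map {X V V' : C} (b : V ⟶ V') (d : 𝒰.Dp X V) : 𝒰.Dp X V' :=
  ⟨d.1, d.2 ≫ b⟩

end Dp

namespace CC

open CSystem

variable {𝒰 : UniverseStr C}

/-! ### Canonical pull-backs in `CC(C, p)` as precomposition -/

theorem consOver_pull {Γ Γ' : CC 𝒰} (f : Γ' ⟶ Γ) (F : int Γ ⟶ 𝒰.U) :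
    (consOver Γ F).pull f = consOver Γ' (intMap f ≫ F) :=
  congrArg (fun g : Γ' ⟶ Γ => consOver Γ' (intMap g ≫ F)) (Category.comp_id f)

theorem u₁_pull {Γ Γ' : CC 𝒰} (f : Γ' ⟶ Γ) (T : ObOver 1 Γ) :
    u₁ Γ' (T.pull f) = intMap f ≫ u₁ Γ T := by
  obtain ⟨F, rfl⟩ := (u₁ Γ).symm.surjective T
  rw [Equiv.apply_symm_apply, ← Equiv.eq_symm_apply]
  exact consOver_pull f F

theorem u₁_bd {Γ : CC 𝒰} (o : TmOver 1 Γ) : u₁ Γ o.bd = uTilde₁ Γ o ≫ 𝒰.p := by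
  obtain ⟨g, rfl⟩ := (uTilde₁ Γ).symm.surjective o
  rw [Equiv.apply_symm_apply]
  exact Category.id_comp (g ≫ 𝒰.p)

/-- The pull-back of the section of `p_{int Γ, g ≫ p}` with `\widetilde u_1`-value `g` along `f` is
the section with value `f ≫ g`. -/
theorem tm_pull_uTilde₁_symm {Γ Γ' : CC 𝒰} (f : Γ' ⟶ Γ) (g : int Γ ⟶ 𝒰.Ut) :
    ((uTilde₁ Γ).symm g).tm.pull f = ((uTilde₁ Γ').symm (intMap f ≫ g)).tm := by
  -- The bases of the two sections differ by associativity of composition, so the section on the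
  -- left is compared by `sectionOver_congr`, which only needs the composites with `Q`.
  let t : int Γ' ⟶ 𝒰.ext (intMap f ≫ g ≫ 𝒰.p) := (((uTilde₁ Γ).symm g).tm.pull f).sec
  have hQ : t ≫ 𝒰.Qmor (intMap f) (g ≫ 𝒰.p) = intMap f ≫
      (𝒰.isPullback (g ≫ 𝒰.p)).lift g (𝟙 (int Γ)) (Category.id_comp _).symm :=
    (((uTilde₁ Γ).symm g).tm.pull_sec_q f).trans (Category.id_comp (obj := C) _)
  have ht : t ≫ 𝒰.Q (intMap f ≫ g ≫ 𝒰.p) = intMap f ≫ g := by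
    rw [← 𝒰.Qmor_Q, ← Category.assoc, hQ, Category.assoc, IsPullback.lift_fst]
  exact congrArg TmOver.tm (sectionOver_congr (Γ := Γ') (s := t)
    (hs := (((uTilde₁ Γ).symm g).tm.pull f).sec_p) (Category.assoc (intMap f) g 𝒰.p).symm
    (ht.trans (IsPullback.lift_fst _ _ _ _).symm))

theorem uTilde₁_pull {Γ Γ' : CC 𝒰} (f : Γ' ⟶ Γ) (o : TmOver 1 Γ) :
    uTilde₁ Γ' (o.pull f) = intMap f ≫ uTilde₁ Γ o := by
  obtain ⟨g, rfl⟩ := (uTilde₁ Γ).symm.surjective o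
  rw [Equiv.apply_symm_apply, ← Equiv.eq_symm_apply]
  refine TmOver.ext (Eq.trans ?_ (tm_pull_uTilde₁_symm f g))
  exact congrArg (fun h : Γ' ⟶ Γ => ((uTilde₁ Γ).symm g).tm.pull h) (Category.comp_id f)

/-- `f^*(n + 1, (A, F)) = (m + 1, (B, f ≫ F))` together with `q(f, (n + 1, (A, F))) = Q(f, F)`. -/
theorem pullData_consOver {Γ Γ' : CC 𝒰} (f : Γ' ⟶ Γ) (F : int Γ ⟶ 𝒰.U) :
    pullData f 1 (consOver Γ F) = ⟨consOver Γ' (intMap f ≫ F), 𝒰.Qmor (intMap f) F⟩ :=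
  congrArg (fun g : Γ' ⟶ Γ => (⟨consOver Γ' (intMap g ≫ F), 𝒰.Qmor (intMap g) F⟩ :
    Σ Δ : ObOver 1 Γ', (Δ.obj ⟶ (consOver Γ F).obj))) (Category.comp_id f)

theorem u₂_pull {Γ Γ' : CC 𝒰} (f : Γ' ⟶ Γ) (T : ObOver 2 Γ) :
    u₂ Γ' (T.pull f) = Dp.pull 𝒰 (intMap f) (u₂ Γ T) := by
  obtain ⟨⟨F, G⟩, rfl⟩ := (u₂ Γ).symm.surjective T
  rw [Equiv.apply_symm_apply, ← Equiv.eq_symm_apply]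
  refine ObOver.ext ?_
  exact congrArg (fun D : Σ Δ : ObOver 1 Γ', (Δ.obj ⟶ (consOver Γ F).obj) =>
    cons D.1.obj (intMap D.2 ≫ G)) (pullData_consOver f F)

theorem uTilde₂_pull {Γ Γ' : CC 𝒰} (f : Γ' ⟶ Γ) (o : TmOver 2 Γ) :
    uTilde₂ Γ' (o.pull f) = Dp.pull 𝒰 (intMap f) (uTilde₂ Γ o) := by
  obtain ⟨⟨F, G⟩, rfl⟩ := (uTilde₂ Γ).symm.surjective o
  rw [Equiv.apply_symm_apply, ← Equiv.eq_symm_apply]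
  refine TmOver.ext (Eq.trans ?_ (tm_pull_uTilde₁_symm (Γ := cons Γ F)
    (Γ' := cons Γ' (intMap f ≫ F)) (𝒰.Qmor (intMap f) F) G))
  exact congrArg (fun D : Σ Δ : ObOver 1 Γ', (Δ.obj ⟶ (consOver Γ F).obj) =>
    ((uTilde₁ (cons Γ F)).symm G).tm.pull D.2) (pullData_consOver f F)

theorem u₂_bd {Γ : CC 𝒰} (o : TmOver 2 Γ) : u₂ Γ o.bd = Dp.map 𝒰 𝒰.p (uTilde₂ Γ o) := by
  obtain ⟨⟨F, G⟩, rfl⟩ := (uTilde₂ Γ).symm.surjective o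
  rw [Equiv.apply_symm_apply, ← Equiv.eq_symm_apply]
  rfl

end CC

end UniverseStr

namespace LCCStr

variable {C : Type u} [Category.{v} C] (L : LCCStr C) (𝒰 : UniverseStr C)

open CSystem UniverseStr

/-! ### Naturality of `η` -/

theorem etaInv_comp {X X' V : C} (f : X' ⟶ X) (g : X ⟶ L.Ip 𝒰 V) :
    L.etaInv 𝒰 X' V (f ≫ g) = Dp.pull 𝒰 f (L.etaInv 𝒰 X V g) := by
  refine 𝒰.Dp_ext (Category.assoc f g _) ?_
  refine (congrArg (· ≫ L.st 𝒰 V) (𝒰.Qmor_comp f g _)).trans ?_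
  exact (Category.assoc _ _ _).trans (congrArg (_ ≫ ·) (Category.assoc _ _ _))

/-- `st_p` is natural in `V`, by the naturality of the evaluation. -/
theorem Qmor_IpMap_st {V V' : C} (b : V ⟶ V') (h : L.IpMap 𝒰 b ≫ L.prIp 𝒰 V' = L.prIp 𝒰 V) :
    𝒰.Qmor (L.IpMap 𝒰 b) (L.prIp 𝒰 V') ≫ L.st 𝒰 V' =
      eqToHom (congrArg 𝒰.ext h) ≫ L.st 𝒰 V ≫ b := by
  have hι : 𝒰.Qmor (L.IpMap 𝒰 b) (L.prIp 𝒰 V') ≫ L.iota 𝒰 (L.prIp 𝒰 V') =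
      eqToHom (congrArg 𝒰.ext h) ≫ L.iota 𝒰 (L.prIp 𝒰 V) ≫
        L.map (L.IpMap 𝒰 b) (𝟙 𝒰.Ut) h (Category.id_comp 𝒰.p) := by
    refine (L.isPullback _ _).hom_ext ?_ ?_
    · simp only [iota, FiberProducts.map, Category.assoc, IsPullback.lift_fst,
        IsPullback.lift_fst_assoc, 𝒰.Qmor_proj]
      rw [← 𝒰.proj_eqToHom h, Category.assoc]
    · simp only [iota, FiberProducts.map, Category.assoc, IsPullback.lift_snd,
        𝒰.Qmor_Q, Category.comp_id]
      rw [← 𝒰.Q_eqToHom h]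
  have hsnd : L.idTimes 𝒰 𝒰.U b ≫ L.snd 𝒰 𝒰.U V' = L.snd 𝒰 𝒰.U V ≫ b :=
    (L.isPullback _ _).lift_snd _ _ _
  have hev : L.map (L.IpMap 𝒰 b) (𝟙 𝒰.Ut) h (Category.id_comp 𝒰.p) ≫
      L.ev 𝒰.p (L.fst 𝒰 𝒰.U V') = L.ev 𝒰.p (L.fst 𝒰 𝒰.U V) ≫ L.idTimes 𝒰 𝒰.U b :=
    L.ev_natural 𝒰.p (L.idTimes 𝒰 𝒰.U b) (L.idTimes_fst 𝒰 𝒰.U b)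
  rw [st, ← Category.assoc, hι, st]
  simp only [Category.assoc]
  rw [← hsnd, ← Category.assoc (L.ev 𝒰.p (L.fst 𝒰 𝒰.U V)), ← hev, Category.assoc]

theorem etaInv_comp_IpMap {X V V' : C} (g : X ⟶ L.Ip 𝒰 V) (b : V ⟶ V') :
    L.etaInv 𝒰 X V' (g ≫ L.IpMap 𝒰 b) = Dp.map 𝒰 b (L.etaInv 𝒰 X V g) := by
  have h : L.IpMap 𝒰 b ≫ L.prIp 𝒰 V' = L.prIp 𝒰 V := L.homMap_tri _ _ _
  have hQ : ∀ {F : L.Ip 𝒰 V ⟶ 𝒰.U} (e : F = L.prIp 𝒰 V),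
      𝒰.Qmor g F ≫ eqToHom (congrArg 𝒰.ext e) =
        eqToHom (congrArg (fun F' => 𝒰.ext (g ≫ F')) e) ≫ 𝒰.Qmor g (L.prIp 𝒰 V) := by
    rintro F rfl
    simp
  refine 𝒰.Dp_ext ((Category.assoc _ _ _).trans (congrArg (g ≫ ·) h)) ?_
  have key : 𝒰.Qmor (g ≫ L.IpMap 𝒰 b) (L.prIp 𝒰 V') ≫ L.st 𝒰 V' =
      eqToHom (congrArg 𝒰.ext ((Category.assoc _ _ _).trans (congrArg (g ≫ ·) h))) ≫
        (𝒰.Qmor g (L.prIp 𝒰 V) ≫ L.st 𝒰 V) ≫ b := by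
    rw [𝒰.Qmor_comp]
    simp only [Category.assoc]
    rw [Qmor_IpMap_st L 𝒰 b h, ← Category.assoc (𝒰.Qmor g _), hQ h]
    simp only [Category.assoc, eqToHom_trans_assoc]
  exact key

theorem eta_pull {X X' V : C} (f : X' ⟶ X) (d : 𝒰.Dp X V) :
    L.eta 𝒰 X' V (Dp.pull 𝒰 f d) = f ≫ L.eta 𝒰 X V d := by
  obtain ⟨g, rfl⟩ := (L.eta 𝒰 X V).symm.surjective d
  rw [Equiv.apply_symm_apply, ← Equiv.eq_symm_apply]
  exact (L.etaInv_comp 𝒰 f g).symm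

theorem eta_map {X V V' : C} (b : V ⟶ V') (d : 𝒰.Dp X V) :
    L.eta 𝒰 X V' (Dp.map 𝒰 b d) = L.eta 𝒰 X V d ≫ L.IpMap 𝒰 b := by
  obtain ⟨g, rfl⟩ := (L.eta 𝒰 X V).symm.surjective d
  rw [Equiv.apply_symm_apply, ← Equiv.eq_symm_apply]
  exact (L.etaInv_comp_IpMap 𝒰 g b).symm

/-! ### The `(Π, λ)`-structure -/

theorem mu₂_pull {Γ Γ' : CC 𝒰} (f : Γ' ⟶ Γ) (T : ObOver 2 Γ) :
    L.mu₂ 𝒰 Γ' (T.pull f) = CC.intMap f ≫ L.mu₂ 𝒰 Γ T :=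
  (congrArg (L.eta 𝒰 _ _) (CC.u₂_pull f T)).trans (L.eta_pull 𝒰 _ _)

theorem muTilde₂_pull {Γ Γ' : CC 𝒰} (f : Γ' ⟶ Γ) (s : TmOver 2 Γ) :
    L.muTilde₂ 𝒰 Γ' (s.pull f) = CC.intMap f ≫ L.muTilde₂ 𝒰 Γ s :=
  (congrArg (L.eta 𝒰 _ _) (CC.uTilde₂_pull f s)).trans (L.eta_pull 𝒰 _ _)

theorem mu₂_bd {Γ : CC 𝒰} (s : TmOver 2 Γ) :
    L.mu₂ 𝒰 Γ s.bd = L.muTilde₂ 𝒰 Γ s ≫ L.IpMap 𝒰 𝒰.p :=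
  (congrArg (L.eta 𝒰 _ _) (CC.u₂_bd s)).trans (L.eta_map 𝒰 _ _)

variable {L 𝒰}

/-- The `(Π, λ)`-structure on `CC(C, p)` given by a `Π`-structure on `p`. -/
noncomputable def PiStr.piLambda (S : L.PiStr 𝒰) : PiLambdaStructure (CC 𝒰) where
  Pi Γ T := (CC.u₁ Γ).symm (L.mu₂ 𝒰 Γ T ≫ S.P)
  lam Γ s := (CC.uTilde₁ Γ).symm (L.muTilde₂ 𝒰 Γ s ≫ S.Pt)
  bd_lam Γ s := by
    rw [Equiv.eq_symm_apply, CC.u₁_bd, Equiv.apply_symm_apply, mu₂_bd, Category.assoc,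
      Category.assoc, S.isPullback.w]
  Pi_pull f T := by
    rw [Equiv.symm_apply_eq, CC.u₁_pull, Equiv.apply_symm_apply, mu₂_pull, Category.assoc]
  lam_pull f s := by
    rw [Equiv.symm_apply_eq, CC.uTilde₁_pull, Equiv.apply_symm_apply, muTilde₂_pull,
      Category.assoc]
  isPullback Γ T r hr := by
    have hw : CC.uTilde₁ Γ r ≫ 𝒰.p = L.mu₂ 𝒰 Γ T ≫ S.P := by
      rw [← CC.u₁_bd, hr, Equiv.apply_symm_apply]
    refine ⟨(L.muTilde₂ 𝒰 Γ).symm (S.isPullback.lift _ _ hw), ⟨?_, ?_⟩, ?_⟩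
    · apply (L.mu₂ 𝒰 Γ).injective
      rw [mu₂_bd, Equiv.apply_symm_apply, S.isPullback.lift_snd]
    · rw [Equiv.symm_apply_eq, Equiv.apply_symm_apply, S.isPullback.lift_fst]
    · rintro s ⟨hsT, hsr⟩
      rw [Equiv.eq_symm_apply]
      refine S.isPullback.hom_ext ?_ ?_
      · rw [S.isPullback.lift_fst, ← hsr, Equiv.apply_symm_apply]
      · rw [S.isPullback.lift_snd, ← mu₂_bd, hsT]

end LCCStr

theorem mainTheorem2 {C : Type u} [Category.{v} C] (L : LCCStr C) (𝒰 : UniverseStr C)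
    (S : L.PiStr 𝒰) :
    ∃ D : CSystem.PiLambdaStructure (UniverseStr.CC 𝒰),
      (∀ (Γ : UniverseStr.CC 𝒰) (T : CSystem.ObOver 2 Γ),
        D.Pi Γ T = (UniverseStr.CC.u₁ Γ).symm (L.mu₂ 𝒰 Γ T ≫ S.P)) ∧
      (∀ (Γ : UniverseStr.CC 𝒰) (s : CSystem.TmOver 2 Γ),
        D.lam Γ s = (UniverseStr.CC.uTilde₁ Γ).symm (L.muTilde₂ 𝒰 Γ s ≫ S.Pt)) :=
  ⟨S.piLambda, fun _ _ => rfl, fun _ _ => rfl⟩
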